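/- Let $p$ be a prime, $h\geq 1$, $q=p^h$ and $n\geq 1$, and let $\theta_{n-1}=(q^n-1)/(q-1)$. Let $C=C(PG(n,q))$ be the $\mathbb{F}_p$-span of the incidence vectors of the hyperplanes of $PG(n,q)$, where the coordinates are indexed by the points of $PG(n,q)$, and let the weight $wt(c)$ of $c \in C$ be the number of its non-zero coordinates. A set $B$ of points of $PG(n,q)$ is a blocking set (with respect to lines) if every line contains at least one point of $B$; it is minimal if no proper subset of $B$ is a blocking set. Regard $\mathbb{F}_q^{n+1}$ as an $h(n+1)$-dimensional vector space over $\mathbb{F}_p$. A linear blocking set is a set of the form $\mathcal{B}(U)$, where $U$ is an $\mathbb{F}_p$-subspace of $\mathbb{F}_q^{n+1}$ of dimension $h(n-1)+1$ (that is, a subspace of $PG((n+1)h-1,p)$ of projective dimension $nh-h$), and $\mathcal{B}(U)$ is the set of those points of $PG(n,q)$ that, as one-dimensional $\mathbb{F}_q$-subspaces, intersect $U$ non-trivially. Then every codeword $c\in C$ with $\theta_{n-1}<wt(c)<2q^{n-1}$ is of the form $c=a\,v_B$, where $a\in\mathbb{F}_p\setminus\{0\}$ and $v_B$ is the incidence vector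 of a minimal blocking set $B$ with respect to lines of $PG(n,q)$ such that $B$ is not a linear blocking set and every line of $PG(n,q)$ meets $B$ in $1 \pmod p$ points. -/

import Mathlib

open scoped LinearAlgebra.Projectivization

noncomputable section

/-- The points of `PG(n,q)`, where `q` is the order of the field `F`. -/
abbrev PG (n : ℕ) (F : Type*) [Field F] : Type _ := ℙ F (Fin (n + 1) → F)

/-- `θ_m = (q^{m+1} - 1) / (q - 1)`, the number of points of `PG(m,q)`
(the division is exact for `q ≥ 2`). -/
def theta (q m : ℕ) : ℕ := (q ^ (m + 1) - 1) / (q - 1)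

/-- The set of points of the projective subspace with underlying vector space `W`. -/
def pointSet {n : ℕ} {F : Type*} [Field F] (W : Submodule F (Fin (n + 1) → F)) : Set (PG n F) :=
  {P | P.submodule ≤ W}

/-- A line of `PG(n,q)`: the points of a vector subspace of dimension `2`. -/
def IsLine {n : ℕ} {F : Type*} [Field F] (L : Set (PG n F)) : Prop :=
  ∃ W : Submodule F (Fin (n + 1) → F), Module.finrank F W = 2 ∧ L = pointSet W

/-- The hyperplanes of `PG(n,q)`: vector subspaces of dimension `n` of `F^{n+1}`. -/
def Hyperplane (n : ℕ) (F : Type*) [Field F] : Type _ :=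
  {W : Submodule F (Fin (n + 1) → F) // Module.finrank F W = n}

/-- The incidence vector, over `𝔽_p`, of a set of points. -/
def incidenceVector (p : ℕ) {n : ℕ} {F : Type*} [Field F] (B : Set (PG n F)) :
    PG n F → ZMod p :=
  B.indicator (fun _ => 1)

/-- The incidence matrix of `PG(n,q)`: rows are indexed by hyperplanes, columns by points. -/
def incidenceMatrix (p n : ℕ) (F : Type*) [Field F] :
    Matrix (Hyperplane n F) (PG n F) (ZMod p) :=
  Matrix.of fun H => incidenceVector p (pointSet H.1)

/-- The `p`-ary linear code `C(PG(n,q))`: the `𝔽_p`-span of the rows of the incidence matrix. -/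
def code (p n : ℕ) (F : Type*) [Field F] : Submodule (ZMod p) (PG n F → ZMod p) :=
  Submodule.span (ZMod p) (Set.range fun H : Hyperplane n F => (incidenceMatrix p n F).row H)

/-- The weight of a vector: the size of its support. -/
def wt {p n : ℕ} {F : Type*} [Field F] (c : PG n F → ZMod p) : ℕ :=
  (Function.support c).ncard

/-- A blocking set with respect to lines: every line contains at least one of its points. -/
def IsBlockingSet {n : ℕ} {F : Type*} [Field F] (B : Set (PG n F)) : Prop :=
  ∀ L : Set (PG n F), IsLine L → (L ∩ B).Nonempty

/-- A blocking set is minimal if no proper subset of it is a blocking set. -/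
def IsMinimalBlockingSet {n : ℕ} {F : Type*} [Field F] (B : Set (PG n F)) : Prop :=
  IsBlockingSet B ∧ ∀ B' : Set (PG n F), B' ⊂ B → ¬ IsBlockingSet B'

/-- Field reduction: the element of the Desarguesian spread of `PG((n+1)h-1,p)` that corresponds
to a point of `PG(n,q)`, `q = p^h`. It is the one-dimensional `F`-subspace of `F^{n+1}`
defining the point, seen as an `h`-dimensional `𝔽_p`-subspace. -/
def spreadElement (p : ℕ) {n : ℕ} {F : Type*} [Field F] [Algebra (ZMod p) F] (P : PG n F) :
    Submodule (ZMod p) (Fin (n + 1) → F) :=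
  P.submodule.restrictScalars (ZMod p)

/-- `B(U)`: the points of `PG(n,q)` whose spread element meets the subspace `U` of
`PG((n+1)h-1,p)` in at least one point, i.e. in a nonzero vector subspace. -/
def spreadBlock {p n : ℕ} {F : Type*} [Field F] [Algebra (ZMod p) F]
    (U : Submodule (ZMod p) (Fin (n + 1) → F)) : Set (PG n F) :=
  {P | U ⊓ spreadElement p P ≠ ⊥}

/-- A linear blocking set (with respect to lines) of `PG(n,p^h)`: a set `B(U)` with `U` a subspace
of `PG((n+1)h-1,p)` of projective dimension `nh - h`, i.e. of vector space dimension
`h(n-1) + 1` over `𝔽_p`. -/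
def IsLinearBlockingSet (p h : ℕ) {n : ℕ} {F : Type*} [Field F] [Algebra (ZMod p) F]
    (B : Set (PG n F)) : Prop :=
  ∃ U : Submodule (ZMod p) (Fin (n + 1) → F),
    Module.finrank (ZMod p) U = h * (n - 1) + 1 ∧ B = spreadBlock U

end

/-! ### Polynomial method in AG(2,q). -/

section AffinePlane

open MvPolynomial

variable {F : Type*} [Field F]

/-! A hyperplane meets a line in 1 or q + 1 points, so a codeword c has the same sum a on all lines.
On an affine plane the indicator of a hyperplane is `1 - φ^(q-1)`, so there c is orthogonal to all
polynomials of degree below q - 1 (`sum_vecFun_mul_eval_eq_zero`).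

Suppose a line contains two support points and a zero of c (two zeros if a = 0). In every plane
through it, the support has at least 2(q - 1) points off the line
(`two_mul_card_sub_one_le_card_support`): Jamison's bound applies if all affine lines are met, and
otherwise orthogonality to products of linear forms or the line sums do. Summing over the planes and
adding the two points on the line gives weight at least 2q^(n-1) (`two_mul_pow_le_wt`).

Below that weight, counting on the lines through a support point yields a ≠ 0 (`line_sum_ne_zero`)
and a tangent at every support point (`exists_tangent`). The sum on a tangent shows that c takes the
value a there, tangents give minimality, and the line sums give the congruence.

Nonlinearity comes from `IsLinearBlockingSet.ncard_le_theta`: a line through a point outside the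
support has at most one support point, so the support has at most θ_{n-1} points. Linearity enters
only through |B| < 2q^(n-1); the same count applied to c shows that the weight interval in fact
contains no codeword. -/

/-- The linear form on `F²` with coefficient vector `d`, as a polynomial. -/
noncomputable def linearFormPoly (d : Fin 2 → F) : MvPolynomial (Fin 2) F :=
  C (d 0) * X 0 + C (d 1) * X 1

theorem eval_linearFormPoly (d z : Fin 2 → F) : eval z (linearFormPoly d) = d ⬝ᵥ z := by
  simp [linearFormPoly, dotProduct, Fin.sum_univ_two]

theorem totalDegree_linearFormPoly_le (d : Fin 2 → F) : (linearFormPoly d).totalDegree ≤ 1 := by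
  have h : ∀ i : Fin 2, (C (d i) * X i : MvPolynomial (Fin 2) F).totalDegree ≤ 1 := fun i =>
    (totalDegree_mul _ _).trans (by simp)
  exact (totalDegree_add _ _).trans (max_le (h 0) (h 1))

theorem totalDegree_C_sub_linearFormPoly_le (b : F) (d : Fin 2 → F) :
    (C b - linearFormPoly d).totalDegree ≤ 1 :=
  (totalDegree_sub _ _).trans (max_le (by simp) (totalDegree_linearFormPoly_le d))

theorem totalDegree_prod_C_sub_linearFormPoly_le {ι : Type*} (s : Finset ι) (b : ι → F)
    (d : ι → Fin 2 → F) :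
    (∏ i ∈ s, (C (b i) - linearFormPoly (d i))).totalDegree ≤ s.card := by
  refine (totalDegree_finsetProd _ _).trans ?_
  refine (Finset.sum_le_card_nsmul s _ 1 fun i _ =>
    totalDegree_C_sub_linearFormPoly_le (b i) (d i)).trans (by simp)

/-- `M` serves as a coordinate along the parallel rows `N ⬝ᵥ z = b`. -/
theorem exists_complementary_form {N : Fin 2 → F} (hN : N ≠ 0) :
    ∃ M : Fin 2 → F, ∀ z z', N ⬝ᵥ z = N ⬝ᵥ z' → M ⬝ᵥ z = M ⬝ᵥ z' → z = z' := by
  classical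
  by_cases h0 : N 0 = 0
  · have h1 : N 1 ≠ 0 := fun h1 => hN (by ext i; fin_cases i <;> simp [h0, h1])
    refine ⟨![1, 0], fun z z' h h' => ?_⟩
    simp only [dotProduct, Fin.sum_univ_two, h0, Matrix.cons_val_zero, Matrix.cons_val_one,
      zero_mul, one_mul, zero_add, add_zero] at h h'
    ext i; fin_cases i
    · exact h'
    · exact mul_left_cancel₀ h1 h
  · refine ⟨![0, 1], fun z z' h h' => ?_⟩
    simp only [dotProduct, Fin.sum_univ_two, Matrix.cons_val_zero, Matrix.cons_val_one,
      zero_mul, one_mul, zero_add] at h h'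
    rw [h', add_left_inj] at h
    ext i; fin_cases i
    · exact mul_left_cancel₀ h0 h
    · exact h'

theorem exists_dotProduct_eq {N : Fin 2 → F} (hN : N ≠ 0) (b : F) : ∃ z, N ⬝ᵥ z = b := by
  obtain ⟨i, hi⟩ := Function.ne_iff.1 hN
  classical
  exact ⟨Pi.single i ((N i)⁻¹ * b), by
    rw [dotProduct_single, mul_inv_cancel_left₀ hi]⟩

theorem eq_zero_of_dotProduct_eq_zero {N P Q : Fin 2 → F} (hdet : P 0 * Q 1 - P 1 * Q 0 ≠ 0)
    (hP : N ⬝ᵥ P = 0) (hQ : N ⬝ᵥ Q = 0) : N = 0 := by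
  simp only [dotProduct, Fin.sum_univ_two] at hP hQ
  ext i; fin_cases i
  · exact (mul_eq_zero.1 (show N 0 * (P 0 * Q 1 - P 1 * Q 0) = 0 by
      linear_combination Q 1 * hP - P 1 * hQ)).resolve_right hdet
  · exact (mul_eq_zero.1 (show N 1 * (P 0 * Q 1 - P 1 * Q 0) = 0 by
      linear_combination P 0 * hQ - Q 0 * hP)).resolve_right hdet

variable [Fintype F] [DecidableEq F]

/-- Jamison's bound: a set of points of `AG(2,q)` meeting all lines has at least `2q - 1` points. -/
theorem two_mul_card_le_of_meets_affine_lines (E : Finset (Fin 2 → F))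
    (hE : ∀ d : Fin 2 → F, d ≠ 0 → ∀ b : F, ∃ e ∈ E, d ⬝ᵥ e = b) :
    2 * Fintype.card F ≤ E.card + 1 := by
  obtain ⟨e₀, he₀, -⟩ := hE ![1, 0] (fun h => one_ne_zero (congrFun h 0)) 0
  by_contra! hlt
  have hq : 1 < Fintype.card F := Fintype.one_lt_card
  have hpos : 0 < E.card := Finset.card_pos.2 ⟨e₀, he₀⟩
  -- A factor vanishes at `x` when `e` lies on the line `x ⬝ᵥ e = 1 + x ⬝ᵥ e₀`, which avoids `e₀`.
  -- So `f` is zero except at the origin, where it is 1; its sum over the plane is then 1, although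
  -- its degree is below 2(q - 1).
  set f : MvPolynomial (Fin 2) F := ∏ e ∈ E.erase e₀, (C 1 - linearFormPoly (e - e₀)) with hf
  have hdeg : f.totalDegree < (Fintype.card F - 1) * Fintype.card (Fin 2) := by
    refine (totalDegree_prod_C_sub_linearFormPoly_le _ _ _).trans_lt ?_
    rw [Finset.card_erase_of_mem he₀, Fintype.card_fin]
    omega
  have hsum := sum_eval_eq_zero f hdeg
  rw [Finset.sum_eq_single 0] at hsum
  · rw [hf, eval_prod] at hsum
    refine Finset.prod_ne_zero_iff.2 (fun e _ => ?_) hsum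
    rw [map_sub, eval_C, eval_linearFormPoly, dotProduct_zero, sub_zero]
    exact one_ne_zero
  · intro x _ hx
    obtain ⟨e, he, hxe⟩ := hE x hx (1 + x ⬝ᵥ e₀)
    rw [hf, eval_prod]
    refine Finset.prod_eq_zero (i := e) (Finset.mem_erase.2 ⟨?_, he⟩) ?_
    · rintro rfl
      simp at hxe
    · rw [map_sub, eval_C, eval_linearFormPoly, dotProduct_comm, dotProduct_sub, hxe]
      ring
  · simp

/-- If a function on `F²` is orthogonal to all polynomials of degree less than `q - 1`, then
every line parallel to `r` lines on which it vanishes is such a line itself, or contains at least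
`r + 1` points of its support. -/
theorem card_zero_rows_lt_card_row {A : (Fin 2 → F) → F}
    (hA : ∀ k : MvPolynomial (Fin 2) F, k.totalDegree < Fintype.card F - 1 →
      ∑ z, A z * eval z k = 0)
    {N M : Fin 2 → F} (hNM : ∀ z z', N ⬝ᵥ z = N ⬝ᵥ z' → M ⬝ᵥ z = M ⬝ᵥ z' → z = z')
    {Z : Finset F} (hZ : ∀ b, b ∈ Z ↔ ∀ z, N ⬝ᵥ z = b → A z = 0) {b : F} (hb : b ∉ Z) :
    Z.card < (Finset.univ.filter fun z => N ⬝ᵥ z = b ∧ A z ≠ 0).card := by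
  by_contra! hle
  set E := Finset.univ.filter fun z => N ⬝ᵥ z = b ∧ A z ≠ 0 with hEdef
  obtain ⟨z₀, hz₀⟩ : ∃ z, z ∈ E := by
    rw [hZ] at hb
    push Not at hb
    obtain ⟨z, hz⟩ := hb
    exact ⟨z, by simpa [hEdef] using hz⟩
  have hz₀' : N ⬝ᵥ z₀ = b ∧ A z₀ ≠ 0 := by simpa [hEdef] using hz₀
  have hEpos : 0 < E.card := Finset.card_pos.2 ⟨z₀, hz₀⟩
  have hbZ : b ∈ Zᶜ := Finset.mem_compl.2 hb
  have hcard : (Zᶜ).card + Z.card = Fintype.card F := by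
    rw [add_comm]; exact Finset.card_add_card_compl Z
  have hZpos : 0 < (Zᶜ).card := Finset.card_pos.2 ⟨b, hbZ⟩
  -- The first product kills the nonempty rows other than `b`, the second the support points of row
  -- `b` other than `z₀`. If the row had at most `Z.card` such points, the degree would be at most q
  -- - 2, yet only the nonzero term at `z₀` survives.
  have hdeg := (totalDegree_mul (∏ b' ∈ Zᶜ.erase b, (C b' - linearFormPoly N))
    (∏ z ∈ E.erase z₀, (C (M ⬝ᵥ z) - linearFormPoly M))).trans
    (add_le_add (totalDegree_prod_C_sub_linearFormPoly_le _ _ _)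
      (totalDegree_prod_C_sub_linearFormPoly_le _ _ _))
  have hsum := hA _ (hdeg.trans_lt (by
    rw [Finset.card_erase_of_mem hbZ, Finset.card_erase_of_mem hz₀]
    omega))
  have heval : ∀ z, eval z ((∏ b' ∈ Zᶜ.erase b, (C b' - linearFormPoly N)) *
      (∏ z ∈ E.erase z₀, (C (M ⬝ᵥ z) - linearFormPoly M))) =
      (∏ b' ∈ Zᶜ.erase b, (b' - N ⬝ᵥ z)) * ∏ z' ∈ E.erase z₀, (M ⬝ᵥ z' - M ⬝ᵥ z) := fun z => by
    simp only [map_mul, eval_prod, map_sub, eval_C, eval_linearFormPoly]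
  simp only [heval] at hsum
  rw [Finset.sum_eq_single z₀] at hsum
  · refine mul_ne_zero hz₀'.2 (mul_ne_zero ?_ ?_) hsum
    · refine Finset.prod_ne_zero_iff.2 fun b' hb' => sub_ne_zero.2 ?_
      rw [hz₀'.1]
      exact (Finset.mem_erase.1 hb').1
    · refine Finset.prod_ne_zero_iff.2 fun z hz => sub_ne_zero.2 fun h => ?_
      obtain ⟨hne, hz⟩ := Finset.mem_erase.1 hz
      have hz' : N ⬝ᵥ z = b ∧ A z ≠ 0 := by simpa [hEdef] using hz
      exact hne (hNM z z₀ (hz'.1.trans hz₀'.1.symm) h)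
  · intro z _ hz
    by_cases hAz : A z = 0
    · rw [hAz, zero_mul]
    by_cases hNz : N ⬝ᵥ z = b
    · have hzE : z ∈ E := Finset.mem_filter.2 ⟨Finset.mem_univ _, hNz, hAz⟩
      exact mul_eq_zero_of_right _ (mul_eq_zero_of_right _
        (Finset.prod_eq_zero (Finset.mem_erase.2 ⟨hz, hzE⟩) (sub_self _)))
    · exact mul_eq_zero_of_right _ (mul_eq_zero_of_left
        (Finset.prod_eq_zero (i := N ⬝ᵥ z) (f := fun b' => b' - N ⬝ᵥ z)
          (Finset.mem_erase.2 ⟨hNz, Finset.mem_compl.2 fun h => hAz ((hZ _).1 h z rfl)⟩)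
          (sub_self _)) _)
  · simp

/-- With r empty rows, each of the other q - r rows has at least r + 1 support points, and (q - r)(r
+ 1) - 2(q - 1) = (r - 1)(q - 2 - r) ≥ 0. -/
theorem two_mul_card_sub_one_le_of_zero_rows {A : (Fin 2 → F) → F}
    (hA : ∀ k : MvPolynomial (Fin 2) F, k.totalDegree < Fintype.card F - 1 →
      ∑ z, A z * eval z k = 0)
    {N : Fin 2 → F} (hN : N ≠ 0)
    {Z : Finset F} (hZ : ∀ b, b ∈ Z ↔ ∀ z, N ⬝ᵥ z = b → A z = 0)
    (h1 : 1 ≤ Z.card) (h2 : Z.card + 2 ≤ Fintype.card F) :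
    2 * (Fintype.card F - 1) ≤ (Finset.univ.filter fun z => A z ≠ 0).card := by
  obtain ⟨M, hM⟩ := exists_complementary_form hN
  have hsum := Finset.card_eq_sum_card_fiberwise
    (f := fun z => N ⬝ᵥ z) (s := Finset.univ.filter fun z => A z ≠ 0) (t := Finset.univ)
    (fun _ _ => Finset.mem_coe.2 (Finset.mem_univ _))
  have hle : ∑ b ∈ Zᶜ, (Z.card + 1) ≤ (Finset.univ.filter fun z => A z ≠ 0).card := by
    rw [hsum]
    refine (Finset.sum_le_sum fun b hb => ?_).trans
      (Finset.sum_le_sum_of_subset (Finset.subset_univ Zᶜ))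
    have := card_zero_rows_lt_card_row hA hM hZ (Finset.mem_compl.1 hb)
    rw [Finset.filter_filter]
    simpa only [and_comm, Nat.succ_le_iff] using this
  rw [Finset.sum_const, smul_eq_mul, Finset.card_compl] at hle
  refine le_trans ?_ hle
  obtain ⟨j, hj⟩ := Nat.exists_eq_add_of_le h2
  obtain ⟨i, hi⟩ := Nat.exists_eq_add_of_le h1
  rw [hj, hi, show 1 + i + 2 + j - (1 + i) = 2 + j by omega,
    show 1 + i + 2 + j - 1 = i + j + 2 by omega]
  nlinarith [Nat.zero_le (i * j)]

/-- A function `A` on `AG(2,q)` that is orthogonal to all polynomials of degree less than `q - 1`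
and is extended by `τ` to the line at infinity in such a way that all other lines
have the same sum `a`. If `τ` has two nonzero values and also a zero, two zeros when `a = 0`, then
the support of `A` has at least `2(q - 1)` points. -/
theorem two_mul_card_sub_one_le_card_support {A : (Fin 2 → F) → F}
    (hA : ∀ k : MvPolynomial (Fin 2) F, k.totalDegree < Fintype.card F - 1 →
      ∑ z, A z * eval z k = 0)
    {τ : (Fin 2 → F) → F} {a : F}
    (hτ : ∀ d, d ≠ 0 → ∀ z, τ d + ∑ t : F, A (z + t • d) = a)
    {P Q R : Fin 2 → F} (hPQ : P 0 * Q 1 - P 1 * Q 0 ≠ 0) (hP : τ P ≠ 0) (hQ : τ Q ≠ 0)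
    (hR0 : R ≠ 0) (hR : τ R = 0)
    (hR' : a = 0 → ∃ R' : Fin 2 → F, R 0 * R' 1 - R 1 * R' 0 ≠ 0 ∧ τ R' = 0) :
    2 * (Fintype.card F - 1) ≤ (Finset.univ.filter fun z => A z ≠ 0).card := by
  have hq : 1 < Fintype.card F := Fintype.one_lt_card
  by_cases hblock : ∀ d : Fin 2 → F, d ≠ 0 → ∀ b : F, ∃ e, A e ≠ 0 ∧ d ⬝ᵥ e = b
  · have := two_mul_card_le_of_meets_affine_lines (Finset.univ.filter fun z => A z ≠ 0)
      (fun d hd b => by simpa using hblock d hd b)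
    omega
  push Not at hblock
  obtain ⟨N, hN, b, hb⟩ := hblock
  set Z : Finset F := Finset.univ.filter fun b => ∀ z, N ⬝ᵥ z = b → A z = 0 with hZdef
  have hZ : ∀ b, b ∈ Z ↔ ∀ z, N ⬝ᵥ z = b → A z = 0 := by simp [hZdef]
  have hbZ : b ∈ Z := (hZ b).2 fun z hz => by
    by_contra h
    exact hb z h hz
  have hZ1 : 1 ≤ Z.card := Finset.card_pos.2 ⟨b, hbZ⟩
  by_cases hZ2 : Z.card + 2 ≤ Fintype.card F
  · exact two_mul_card_sub_one_le_of_zero_rows hA hN hZ hZ1 hZ2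
  -- At most one row, `b₀`, can now carry support. Line sums will force `τ` to be constant on all
  -- directions transversal to the rows.
  exfalso
  have hcompl : (Zᶜ).card ≤ 1 := by rw [Finset.card_compl]; omega
  obtain ⟨b₀, hb₀⟩ : ∃ b₀, ∀ b, b ≠ b₀ → b ∈ Z := by
    rcases Finset.eq_empty_or_nonempty Zᶜ with h | ⟨b₀, h⟩
    · exact ⟨0, fun b _ => by
        have := Finset.notMem_empty b
        rw [← h, Finset.mem_compl, not_not] at this
        exact this⟩
    · refine ⟨b₀, fun b hb => ?_⟩
      by_contra h'
      exact hb (Finset.card_le_one.1 hcompl b (Finset.mem_compl.2 h') b₀ h)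
  have hpar : ∀ d, d ≠ 0 → N ⬝ᵥ d = 0 → τ d = a := by
    intro d hd hNd
    obtain ⟨z, hz⟩ := exists_dotProduct_eq hN b
    rw [← hτ d hd z, Finset.sum_eq_zero, add_zero]
    intro t _
    refine (hZ b).1 hbZ _ ?_
    rw [dotProduct_add, dotProduct_smul, hNd, smul_zero, add_zero, hz]
  obtain ⟨z₁, hz₁⟩ := exists_dotProduct_eq hN b₀
  -- A transversal through `z₁` leaves row `b₀` after that one point, so no other term contributes.
  have htrans : ∀ d, N ⬝ᵥ d ≠ 0 → τ d + A z₁ = a := by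
    intro d hNd
    have hd : d ≠ 0 := by rintro rfl; simp at hNd
    rw [← hτ d hd z₁, Finset.sum_eq_single 0]
    · simp
    · intro t _ ht
      refine (hZ _).1 (hb₀ (N ⬝ᵥ (z₁ + t • d)) ?_) _ rfl
      rw [dotProduct_add, dotProduct_smul, hz₁, smul_eq_mul, Ne, add_eq_left]
      exact mul_ne_zero ht hNd
    · simp
  -- If `R` is parallel to the rows, an empty row gives `a = τ R = 0`; this is the case that needs a
  -- second zero.
  have key : ∃ R₁, N ⬝ᵥ R₁ ≠ 0 ∧ τ R₁ = 0 := by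
    by_cases h : N ⬝ᵥ R = 0
    · obtain ⟨R', hdet, hR'⟩ := hR' ((hpar R hR0 h).symm.trans hR)
      exact ⟨R', fun h' => hN (eq_zero_of_dotProduct_eq_zero hdet h h'), hR'⟩
    · exact ⟨R, h, hR⟩
  obtain ⟨R₁, hR₁, hτR₁⟩ := key
  have hzero : ∀ d, N ⬝ᵥ d ≠ 0 → τ d = 0 := fun d hd => by
    have h1 := htrans d hd
    have h2 := htrans R₁ hR₁
    rw [hτR₁, zero_add] at h2
    simpa [h2] using h1
  exact hN (eq_zero_of_dotProduct_eq_zero hPQ (by_contra fun h => hP (hzero P h))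
    (by_contra fun h => hQ (hzero Q h)))

end AffinePlane

/-! ### Codewords as functions of homogeneous coordinates. -/

section HomogeneousCoordinates

variable {n : ℕ} {F : Type*} [Field F] {R : Type*}

open Classical in
/-- A function on the points of `PG(n,q)` as a function of homogeneous coordinates, with value
`0` at the zero vector. -/
noncomputable def vecFun [Zero R] (c : PG n F → R) (x : Fin (n + 1) → F) : R :=
  if h : x = 0 then 0 else c (Projectivization.mk F x h)

theorem vecFun_of_ne_zero [Zero R] (c : PG n F → R) {x : Fin (n + 1) → F} (h : x ≠ 0) :
    vecFun c x = c (Projectivization.mk F x h) := dif_neg h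

@[simp] theorem vecFun_apply_zero [Zero R] (c : PG n F → R) : vecFun c 0 = 0 := dif_pos rfl

theorem vecFun_rep [Zero R] (c : PG n F → R) (P : PG n F) : vecFun c P.rep = c P := by
  rw [vecFun_of_ne_zero c P.rep_nonzero, P.mk_rep]

theorem vecFun_smul_vec [Zero R] (c : PG n F → R) {l : F} (hl : l ≠ 0) (x : Fin (n + 1) → F) :
    vecFun c (l • x) = vecFun c x := by
  by_cases hx : x = 0
  · simp [hx]
  · rw [vecFun_of_ne_zero c hx, vecFun_of_ne_zero c (smul_ne_zero hl hx)]
    congr 1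
    exact (Projectivization.mk_eq_mk_iff' F _ _ _ _).2 ⟨l, rfl⟩

theorem vecFun_add [AddZeroClass R] (c d : PG n F → R) (x : Fin (n + 1) → F) :
    vecFun (c + d) x = vecFun c x + vecFun d x := by
  by_cases hx : x = 0
  · simp [hx]
  · simp [vecFun_of_ne_zero _ hx]

theorem vecFun_smul [MulZeroClass R] (r : R) (c : PG n F → R) (x : Fin (n + 1) → F) :
    vecFun (r • c) x = r * vecFun c x := by
  by_cases hx : x = 0
  · simp [hx]
  · simp [vecFun_of_ne_zero _ hx]

theorem mk_mem_pointSet_iff {W : Submodule F (Fin (n + 1) → F)} {x : Fin (n + 1) → F}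
    (hx : x ≠ 0) : Projectivization.mk F x hx ∈ pointSet W ↔ x ∈ W := by
  simp [pointSet, Projectivization.submodule_mk, Submodule.span_singleton_le_iff_mem]

theorem rep_mem_iff_mem_pointSet {W : Submodule F (Fin (n + 1) → F)} {P : PG n F} :
    P.rep ∈ W ↔ P ∈ pointSet W := by
  rw [← mk_mem_pointSet_iff P.rep_nonzero, P.mk_rep]

/-- A hyperplane is the kernel of a linear form. -/
theorem Hyperplane.exists_dual (H : Hyperplane n F) :
    ∃ φ : (Fin (n + 1) → F) →ₗ[F] F, ∀ x, x ∈ H.1 ↔ φ x = 0 := by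
  have hdim : Module.finrank F (Fin (n + 1) → F) = n + 1 := Module.finrank_fin_fun F
  have hlt : H.1 < ⊤ := lt_top_iff_ne_top.2 fun h => by
    have := H.2
    rw [h, finrank_top, hdim] at this
    omega
  obtain ⟨φ, hφ, hle⟩ := Submodule.exists_le_ker_of_lt_top H.1 hlt
  have hker : H.1 = LinearMap.ker φ := by
    refine Submodule.eq_of_le_of_finrank_le hle ?_
    have h1 := LinearMap.finrank_range_add_finrank_ker φ
    have h2 : Module.finrank F (LinearMap.range φ) ≠ 0 := fun h =>
      hφ (LinearMap.range_eq_bot.1 (Submodule.finrank_eq_zero.1 h))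
    rw [hdim] at h1
    rw [H.2]
    omega
  exact ⟨φ, fun x => by rw [hker, LinearMap.mem_ker]⟩

-- Replaces generators by linear forms, so that later inductions evaluate `φ` instead of handling
-- subspaces.
@[elab_as_elim]
theorem code_induction {p : ℕ} {motive : (c : PG n F → ZMod p) → c ∈ code p n F → Prop}
    (hyperplane : ∀ (c : PG n F → ZMod p) (hc : c ∈ code p n F) (φ : (Fin (n + 1) → F) →ₗ[F] F),
      (∀ x, x ≠ 0 → φ x = 0 → vecFun c x = 1) → (∀ x, φ x ≠ 0 → vecFun c x = 0) → motive c hc)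
    (zero : motive 0 (zero_mem _))
    (add : ∀ c d hc hd, motive c hc → motive d hd → motive (c + d) (add_mem hc hd))
    (smul : ∀ (r : ZMod p) c hc, motive c hc → motive (r • c) (Submodule.smul_mem _ r hc))
    {c : PG n F → ZMod p} (hc : c ∈ code p n F) : motive c hc := by
  refine Submodule.span_induction (p := motive) ?_ zero add smul hc
  rintro _ ⟨H, rfl⟩
  obtain ⟨φ, hφ⟩ := H.exists_dual
  refine hyperplane _ _ φ (fun x hx h => ?_) (fun x h => ?_)
  · rw [vecFun_of_ne_zero _ hx]
    change incidenceVector p (pointSet H.1) _ = 1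
    exact Set.indicator_of_mem ((mk_mem_pointSet_iff hx).2 ((hφ x).2 h)) _
  · have hx : x ≠ 0 := by rintro rfl; simp at h
    rw [vecFun_of_ne_zero _ hx]
    change incidenceVector p (pointSet H.1) _ = 0
    exact Set.indicator_of_notMem (fun h' => h ((hφ x).1 ((mk_mem_pointSet_iff hx).1 h'))) _

end HomogeneousCoordinates

/-! ### Line sums and orthogonality relations of codewords. -/

section CodeSums

variable {p n : ℕ} [Fact p.Prime] {F : Type*} [Field F] [Fintype F] [Algebra (ZMod p) F]

variable (p F) in
theorem natCast_card_eq_zero : (Fintype.card F : ZMod p) = 0 :=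
  (algebraMap (ZMod p) F).injective (by simp)

/-- A codeword has the same sum on all lines. -/
theorem exists_line_sum {c : PG n F → ZMod p} (hc : c ∈ code p n F) :
    ∃ a : ZMod p, ∀ u v : Fin (n + 1) → F, LinearIndependent F ![u, v] →
      vecFun c v + ∑ t : F, vecFun c (u + t • v) = a := by
  induction hc using code_induction with
  | hyperplane c _ φ h1 h0 =>
    refine ⟨1, fun u v huv => ?_⟩
    have hv : v ≠ 0 := huv.ne_zero 1
    have huv' : ∀ t : F, u + t • v ≠ 0 := fun t h => by
      have := (LinearIndependent.pair_iff.1 huv 1 t (by simpa using h)).1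
      exact one_ne_zero this
    -- The line lies in the hyperplane (1 + q = 1 in characteristic p), meets it only in `v`, or
    -- meets it only at the parameter `-(φ u / φ v)`.
    by_cases hφv : φ v = 0
    · rw [h1 v hv hφv]
      by_cases hφu : φ u = 0
      · have : ∀ t : F, vecFun c (u + t • v) = 1 := fun t =>
          h1 _ (huv' t) (by simp [hφu, hφv])
        simp [this, natCast_card_eq_zero p F]
      · have : ∀ t : F, vecFun c (u + t • v) = 0 := fun t =>
          h0 _ (by simpa [hφv] using hφu)
        simp [this]
    · rw [h0 v hφv, zero_add, Finset.sum_eq_single (-(φ u / φ v))]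
      · exact h1 _ (huv' _) (by simp [hφv])
      · intro t _ ht
        refine h0 _ fun h => ht ?_
        rw [map_add, map_smul, smul_eq_mul] at h
        field_simp
        linear_combination h
      · simp
  | zero => exact ⟨0, fun u v _ => by simp [vecFun]⟩
  | add c d _ _ hc hd =>
    obtain ⟨a, ha⟩ := hc
    obtain ⟨b, hb⟩ := hd
    refine ⟨a + b, fun u v h => ?_⟩
    simp only [vecFun_add, Finset.sum_add_distrib]
    rw [← ha u v h, ← hb u v h]
    ring
  | smul r c _ hc =>
    obtain ⟨a, ha⟩ := hc
    refine ⟨r * a, fun u v h => ?_⟩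
    simp only [vecFun_smul, ← Finset.mul_sum]
    rw [← ha u v h]
    ring

/-- The restriction of a codeword to an affine plane is orthogonal to the polynomials of degree
less than `q - 1`. -/
theorem sum_vecFun_mul_eval_eq_zero {c : PG n F → ZMod p} (hc : c ∈ code p n F)
    {u v w : Fin (n + 1) → F} (hw : w ∉ Submodule.span F {u, v}) {k : MvPolynomial (Fin 2) F}
    (hk : k.totalDegree < Fintype.card F - 1) :
    ∑ z : Fin 2 → F, algebraMap (ZMod p) F (vecFun c (w + (z 0 • u + z 1 • v))) *
      MvPolynomial.eval z k = 0 := by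
  have hne : ∀ z : Fin 2 → F, w + (z 0 • u + z 1 • v) ≠ 0 := fun z h => hw <| by
    rw [eq_neg_of_add_eq_zero_left h]
    exact neg_mem (Submodule.mem_span_pair.2 ⟨_, _, rfl⟩)
  have hq : 1 < Fintype.card F := Fintype.one_lt_card
  induction hc using code_induction with
  | hyperplane c _ φ h1 h0 =>
    -- By Fermat, 1 minus the (q-1)-th power of `φ` is the indicator of the hyperplane. It has
    -- degree at most q - 1, so its product with `k` stays below 2(q - 1).
    have hdeg : ((1 - (MvPolynomial.C (φ w) + linearFormPoly ![φ u, φ v]) ^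
        (Fintype.card F - 1)) * k).totalDegree <
        (Fintype.card F - 1) * Fintype.card (Fin 2) := by
      refine (MvPolynomial.totalDegree_mul _ _).trans_lt ?_
      have hlin : (MvPolynomial.C (φ w) + linearFormPoly ![φ u, φ v]).totalDegree ≤ 1 :=
        (MvPolynomial.totalDegree_add _ _).trans
          (max_le (by simp) (totalDegree_linearFormPoly_le _))
      have hpow := (MvPolynomial.totalDegree_pow (MvPolynomial.C (φ w) +
        linearFormPoly ![φ u, φ v]) (Fintype.card F - 1)).trans
        (Nat.mul_le_mul_left (Fintype.card F - 1) hlin)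
      have hsub := (MvPolynomial.totalDegree_sub (1 : MvPolynomial (Fin 2) F)
        ((MvPolynomial.C (φ w) + linearFormPoly ![φ u, φ v]) ^ (Fintype.card F - 1))).trans
        (max_le (by simp) hpow)
      rw [Fintype.card_fin]
      omega
    rw [← MvPolynomial.sum_eval_eq_zero _ hdeg]
    refine Finset.sum_congr rfl fun z _ => ?_
    rw [map_mul, map_sub, map_one, map_pow, map_add, MvPolynomial.eval_C, eval_linearFormPoly]
    have hval : φ (w + (z 0 • u + z 1 • v)) = φ w + ![φ u, φ v] ⬝ᵥ z := by
      simp [dotProduct, Fin.sum_univ_two, mul_comm]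
    rw [← hval]
    congr 1
    by_cases h : φ (w + (z 0 • u + z 1 • v)) = 0
    · rw [h1 _ (hne z) h, h, zero_pow (by omega), map_one, sub_zero]
    · rw [h0 _ h, FiniteField.pow_card_sub_one_eq_one _ h, map_zero, sub_self]
  | zero => simp [vecFun]
  | add c d _ _ hc hd =>
    simp only [vecFun_add, map_add, add_mul, Finset.sum_add_distrib, hc, hd, add_zero]
  | smul r c _ hc =>
    simp only [vecFun_smul, map_mul, mul_assoc, ← Finset.mul_sum, hc, mul_zero]

/-- In every plane through a line `⟨u, v⟩` that contains two points in the support of a codeword,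
and a point (two points, if the line sums are zero) outside it, the
support has at least `2(q - 1)` points outside the line. -/
theorem two_mul_card_sub_one_le_card_vecFun_ne_zero [DecidableEq F] {c : PG n F → ZMod p}
    (hc : c ∈ code p n F) {a : ZMod p}
    (ha : ∀ u v : Fin (n + 1) → F, LinearIndependent F ![u, v] →
      vecFun c v + ∑ t : F, vecFun c (u + t • v) = a)
    {u v w : Fin (n + 1) → F} (huv : LinearIndependent F ![u, v])
    (hw : w ∉ Submodule.span F {u, v})
    {P Q R : Fin 2 → F} (hPQ : P 0 * Q 1 - P 1 * Q 0 ≠ 0)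
    (hP : vecFun c (P 0 • u + P 1 • v) ≠ 0) (hQ : vecFun c (Q 0 • u + Q 1 • v) ≠ 0)
    (hR0 : R ≠ 0) (hR : vecFun c (R 0 • u + R 1 • v) = 0)
    (hR' : a = 0 → ∃ R' : Fin 2 → F, R 0 * R' 1 - R 1 * R' 0 ≠ 0 ∧
      vecFun c (R' 0 • u + R' 1 • v) = 0) :
    2 * (Fintype.card F - 1) ≤
      (Finset.univ.filter fun z : Fin 2 → F => vecFun c (w + (z 0 • u + z 1 • v)) ≠ 0).card := by
  have hinj := (algebraMap (ZMod p) F).injective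
  have := two_mul_card_sub_one_le_card_support
    (A := fun z => algebraMap (ZMod p) F (vecFun c (w + (z 0 • u + z 1 • v))))
    (τ := fun d => algebraMap (ZMod p) F (vecFun c (d 0 • u + d 1 • v)))
    (a := algebraMap (ZMod p) F a) (fun k hk => sum_vecFun_mul_eval_eq_zero hc hw hk)
    (fun d hd z => ?_) hPQ (by simpa using hP) (by simpa using hQ) hR0 (by simp [hR])
    (fun h => ?_)
  · simpa using this
  · have hd' : d 0 • u + d 1 • v ≠ 0 := fun h => by
      obtain ⟨h0, h1⟩ := LinearIndependent.pair_iff.1 huv _ _ h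
      exact hd (by ext i; fin_cases i <;> assumption)
    have hli : LinearIndependent F ![w + (z 0 • u + z 1 • v), d 0 • u + d 1 • v] := by
      refine LinearIndependent.pair_iff.2 fun s t hst => ?_
      have hs : s = 0 := by
        by_contra hs
        refine hw (Submodule.mem_span_pair.2
          ⟨-(z 0 + s⁻¹ * t * d 0), -(z 1 + s⁻¹ * t * d 1), ?_⟩)
        have h := congrArg (s⁻¹ • ·) hst
        simp only [smul_add, smul_smul, inv_mul_cancel₀ hs, one_smul, smul_zero,
          inv_mul_cancel_left₀ hs] at h
        rw [← sub_eq_zero, ← neg_eq_zero, ← h]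
        module
      rw [hs, zero_smul, zero_add] at hst
      exact ⟨hs, (smul_eq_zero.1 hst).resolve_right hd'⟩
    have h := congrArg (algebraMap (ZMod p) F) (ha _ _ hli)
    rw [map_add, map_sum] at h
    rw [← h]
    congr 1
    refine Finset.sum_congr rfl fun t _ => ?_
    congr 2
    simp only [Pi.add_apply, Pi.smul_apply, smul_eq_mul]
    module
  · obtain ⟨R', h1, h2⟩ := hR' (hinj (by simpa using h))
    exact ⟨R', h1, by simp [h2]⟩

end CodeSums

/-! ### Counting support points by vectors. -/

section Counting

theorem pointSet_span_rep {n : ℕ} {F : Type*} [Field F] (P : PG n F) :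
    pointSet (Submodule.span F {P.rep}) = {P} := by
  ext Q
  rw [← rep_mem_iff_mem_pointSet, Submodule.mem_span_singleton, Set.mem_singleton_iff]
  conv_rhs => rw [← Q.mk_rep, ← P.mk_rep]
  rw [Projectivization.mk_eq_mk_iff']

theorem theta_mul {q n : ℕ} (hn : 1 ≤ n) :
    theta q (n - 1) * (q - 1) = q ^ n - 1 := by
  rw [theta, Nat.sub_add_cancel hn]
  refine Nat.div_mul_cancel ?_
  simpa using Nat.sub_dvd_pow_sub_pow q 1 n

theorem linearIndependent_pair_of_notMem_span {n : ℕ} {F : Type*} [Field F]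
    {r w : Fin (n + 1) → F} (hr : r ≠ 0)
    (hw : w ∉ Submodule.span F {r}) : LinearIndependent F ![r, w] := by
  refine (LinearIndependent.pair_iff' hr).2 fun a ha => hw ?_
  exact Submodule.mem_span_singleton.2 ⟨a, ha⟩

variable {n : ℕ} {F : Type*} [Field F] [Fintype F] {R : Type*} [Zero R] [DecidableEq R]

open Classical in
theorem card_filter_notMem_vecFun_ne_zero (c : PG n F → R) (L : Submodule F (Fin (n + 1) → F)) :
    (Finset.univ.filter fun x => x ∉ L ∧ vecFun c x ≠ 0).card =
      (Fintype.card F - 1) * (Function.support c \ pointSet L).ncard := by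
  have hfin : (Function.support c \ pointSet L).Finite := Set.toFinite _
  rw [Set.ncard_eq_toFinset_card _ hfin, ← Fintype.card_units, ← Finset.card_univ,
    ← Finset.card_product]
  symm
  refine Finset.card_bij (fun x _ => x.1 • x.2.rep) ?_ ?_ ?_
  · rintro ⟨l, P⟩ hP
    simp only [Finset.mem_product, Finset.mem_univ, true_and, Set.Finite.mem_toFinset,
      Set.mem_sdiff, Function.mem_support] at hP
    simp only [Finset.mem_filter, Finset.mem_univ, true_and, Units.smul_def]
    rw [vecFun_smul_vec _ l.ne_zero, vecFun_rep, Submodule.smul_mem_iff _ l.ne_zero,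
      rep_mem_iff_mem_pointSet]
    exact ⟨hP.2, hP.1⟩
  · rintro ⟨l, P⟩ _ ⟨m, Q⟩ _ h
    simp only [Units.smul_def] at h
    have hPQ : P = Q := by
      rw [← P.mk_rep, ← Q.mk_rep, Projectivization.mk_eq_mk_iff']
      refine ⟨(l : F)⁻¹ * m, ?_⟩
      rw [mul_smul, ← h, inv_smul_smul₀ l.ne_zero]
    subst hPQ
    exact Prod.ext (Units.ext (smul_left_injective F P.rep_nonzero h)) rfl
  · intro x hx
    simp only [Finset.mem_filter, Finset.mem_univ, true_and] at hx
    have hx0 : x ≠ 0 := by rintro rfl; simp at hx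
    obtain ⟨a, ha⟩ := Projectivization.exists_smul_eq_mk_rep F x hx0
    refine ⟨⟨a⁻¹, Projectivization.mk F x hx0⟩, ?_, ?_⟩
    · simp only [Finset.mem_product, Finset.mem_univ, true_and, Set.Finite.mem_toFinset,
        Set.mem_sdiff, Function.mem_support, mk_mem_pointSet_iff hx0]
      rw [vecFun_of_ne_zero _ hx0] at hx
      exact hx.symm
    · rw [← ha, inv_smul_smul]

-- Translation by `e g ∈ L` permutes the vectors outside `L`, so each support vector there is
-- counted once per `g`. With `G = F²` or `G = F` this replaces a count over planes through a line
-- or lines through a point.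
open Classical in
theorem sum_card_translate_vecFun_ne_zero (c : PG n F → R) (L : Submodule F (Fin (n + 1) → F))
    {G : Type*} [Fintype G] (e : G → Fin (n + 1) → F) (he : ∀ g, e g ∈ L) :
    ∑ w ∈ Finset.univ.filter (fun w => w ∉ L),
      (Finset.univ.filter fun g => vecFun c (w + e g) ≠ 0).card =
      Fintype.card G * ((Fintype.card F - 1) * (Function.support c \ pointSet L).ncard) := by
  simp only [Finset.card_filter (fun g => vecFun c (_ + e g) ≠ 0)]
  rw [Finset.sum_comm, ← card_filter_notMem_vecFun_ne_zero, ← Finset.card_univ, ← smul_eq_mul,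
    ← Finset.sum_const]
  refine Finset.sum_congr rfl fun g _ => ?_
  rw [← Finset.card_filter, Finset.filter_filter]
  refine Finset.card_nbij' (· + e g) (· - e g) ?_ ?_ ?_ ?_
  · intro w hw
    simpa [Submodule.add_mem_iff_left _ (he g)] using hw
  · intro w hw
    simpa [Submodule.sub_mem_iff_left _ (he g)] using hw
  · intro w _; simp
  · intro w _; simp

open Classical in
theorem card_filter_notMem (L : Submodule F (Fin (n + 1) → F)) :
    (Finset.univ.filter fun w => w ∉ L).card =
      Fintype.card F ^ (n + 1) - Fintype.card F ^ Module.finrank F L := by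
  have h1 : (Finset.univ.filter fun w => w ∈ L).card =
      Fintype.card F ^ Module.finrank F L := by
    rw [← Module.card_eq_pow_finrank (K := F) (V := L), Fintype.card_subtype]
  rw [← Finset.compl_filter, Finset.card_compl, h1]
  simp

open Classical in
theorem sum_card_lines_through (c : PG n F → R) (P : PG n F) :
    ∑ w ∈ Finset.univ.filter (fun w => w ∉ Submodule.span F {P.rep}),
      (Finset.univ.filter fun t : F => vecFun c (w + t • P.rep) ≠ 0).card =
      Fintype.card F * ((Fintype.card F - 1) * (Function.support c \ {P}).ncard) := by
  rw [sum_card_translate_vecFun_ne_zero c _ (fun t : F => t • P.rep)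
    (fun t => Submodule.smul_mem _ t (Submodule.mem_span_singleton_self _)), pointSet_span_rep]

open Classical in
theorem card_filter_notMem_span_rep (P : PG n F) :
    (Finset.univ.filter fun w => w ∉ Submodule.span F {P.rep}).card =
      Fintype.card F * (Fintype.card F ^ n - 1) := by
  rw [card_filter_notMem, finrank_span_singleton P.rep_nonzero, Nat.mul_sub, pow_succ, pow_one,
    mul_one, mul_comm]

open Classical in
/-- If every line through `P` has at least `j` points other than `P` in the support of `c`, then
this support has at least `j · θ_{n-1}` points other than `P`. -/
theorem le_ncard_support_diff_singleton (c : PG n F → R) (P : PG n F) (j : ℕ)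
    (h : ∀ w, w ∉ Submodule.span F {P.rep} →
      j ≤ (Finset.univ.filter fun t : F => vecFun c (w + t • P.rep) ≠ 0).card) :
    (Fintype.card F ^ n - 1) * j ≤
      (Fintype.card F - 1) * (Function.support c \ {P}).ncard := by
  have h1 := Finset.card_nsmul_le_sum (Finset.univ.filter (fun w => w ∉ Submodule.span F {P.rep}))
    _ j fun w hw => h w (Finset.mem_filter.1 hw).2
  rw [sum_card_lines_through, card_filter_notMem_span_rep, smul_eq_mul, mul_assoc] at h1
  exact Nat.le_of_mul_le_mul_left h1 Fintype.card_pos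

open Classical in
theorem ncard_support_diff_singleton_le (c : PG n F → R) (P : PG n F) (j : ℕ)
    (h : ∀ w, w ∉ Submodule.span F {P.rep} →
      (Finset.univ.filter fun t : F => vecFun c (w + t • P.rep) ≠ 0).card ≤ j) :
    (Fintype.card F - 1) * (Function.support c \ {P}).ncard ≤
      (Fintype.card F ^ n - 1) * j := by
  have h1 := Finset.sum_le_card_nsmul (Finset.univ.filter (fun w => w ∉ Submodule.span F {P.rep}))
    _ j fun w hw => h w (Finset.mem_filter.1 hw).2
  rw [sum_card_lines_through, card_filter_notMem_span_rep, smul_eq_mul, mul_assoc] at h1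
  exact Nat.le_of_mul_le_mul_left h1 Fintype.card_pos

end Counting

/-! ### Weight bounds and their consequences below 2q^(n-1). -/

section WeightBounds

variable {p n : ℕ} [Fact p.Prime] {F : Type*} [Field F] [Fintype F] [Algebra (ZMod p) F]

/-- If a line contains two points in the support of a codeword and a point (two points, if the line
sums are zero) outside it, then the codeword has weight at least `2q^{n-1}`. -/
theorem two_mul_pow_le_wt (hn : 1 ≤ n) {c : PG n F → ZMod p}
    (hc : c ∈ code p n F) {a : ZMod p}
    (ha : ∀ u v : Fin (n + 1) → F, LinearIndependent F ![u, v] →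
      vecFun c v + ∑ t : F, vecFun c (u + t • v) = a)
    {u v : Fin (n + 1) → F} (huv : LinearIndependent F ![u, v])
    (P Q R : Fin 2 → F) (hPQ : P 0 * Q 1 - P 1 * Q 0 ≠ 0)
    (hP : vecFun c (P 0 • u + P 1 • v) ≠ 0) (hQ : vecFun c (Q 0 • u + Q 1 • v) ≠ 0)
    (hR0 : R ≠ 0) (hR : vecFun c (R 0 • u + R 1 • v) = 0)
    (hR' : a = 0 → ∃ R' : Fin 2 → F, R 0 * R' 1 - R 1 * R' 0 ≠ 0 ∧
      vecFun c (R' 0 • u + R' 1 • v) = 0) :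
    2 * Fintype.card F ^ (n - 1) ≤ wt c := by
  classical
  have hq : 1 < Fintype.card F := Fintype.one_lt_card
  set q := Fintype.card F with hqdef
  set L := Submodule.span F {u, v} with hL
  have hrank : Module.finrank F L = 2 := by
    have := finrank_span_eq_card huv
    rwa [Matrix.range_cons_cons_empty, Fintype.card_fin] at this
  have hsum := sum_card_translate_vecFun_ne_zero c L (fun z : Fin 2 → F => z 0 • u + z 1 • v)
    (fun z => Submodule.mem_span_pair.2 ⟨_, _, rfl⟩)
  have hle := Finset.card_nsmul_le_sum (Finset.univ.filter (fun w => w ∉ L)) _ (2 * (q - 1))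
    fun w hw => two_mul_card_sub_one_le_card_vecFun_ne_zero hc ha huv (Finset.mem_filter.1 hw).2
      hPQ hP hQ hR0 hR hR'
  rw [hsum, card_filter_notMem, hrank, smul_eq_mul, Fintype.card_fun, Fintype.card_fin,
    ← hqdef] at hle
  have hpow : q ^ (n + 1) = q ^ 2 * q ^ (n - 1) := by
    rw [← pow_add]; congr 1; omega
  -- Each plane through the line arises from q²(q - 1) vectors `w`; cancelling this factor leaves
  -- the sum over planes.
  have hm : 2 * (q ^ (n - 1) - 1) ≤ (Function.support c \ pointSet L).ncard := by
    refine Nat.le_of_mul_le_mul_left (c := q ^ 2 * (q - 1)) ?_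
      (Nat.mul_pos (pow_pos (by omega) 2) (by omega))
    calc q ^ 2 * (q - 1) * (2 * (q ^ (n - 1) - 1))
        = (q ^ 2 * q ^ (n - 1) - q ^ 2) * (2 * (q - 1)) := by
          rw [← Nat.mul_sub_one]; ring
      _ ≤ _ := by rw [← hpow]; exact hle.trans_eq (by ring)
  have hP0 : P 0 • u + P 1 • v ≠ 0 := fun h => hP (by rw [h, vecFun_apply_zero])
  have hQ0 : Q 0 • u + Q 1 • v ≠ 0 := fun h => hQ (by rw [h, vecFun_apply_zero])
  have hne : Projectivization.mk F _ hP0 ≠ Projectivization.mk F _ hQ0 := by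
    rw [Ne, Projectivization.mk_eq_mk_iff']
    rintro ⟨s, hs⟩
    have h := LinearIndependent.pair_iff.1 huv (s * Q 0 - P 0) (s * Q 1 - P 1) (by
      rw [← sub_eq_zero.2 hs]; module)
    exact hPQ (by linear_combination (-Q 1) * h.1 + Q 0 * h.2)
  -- The points given by `P` and `Q` supply the 2 missing from 2(q^(n-1) - 1).
  have htwo : 2 ≤ (Function.support c ∩ pointSet L).ncard := by
    rw [← Set.ncard_pair hne]
    refine Set.ncard_le_ncard (Set.insert_subset ⟨?_, ?_⟩ (Set.singleton_subset_iff.2 ⟨?_, ?_⟩))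
      (Set.toFinite _)
    · rwa [vecFun_of_ne_zero _ hP0] at hP
    · exact (mk_mem_pointSet_iff _).2 (Submodule.mem_span_pair.2 ⟨_, _, rfl⟩)
    · rwa [vecFun_of_ne_zero _ hQ0] at hQ
    · exact (mk_mem_pointSet_iff _).2 (Submodule.mem_span_pair.2 ⟨_, _, rfl⟩)
  have htot := Set.ncard_inter_add_ncard_sdiff_eq_ncard (Function.support c) (pointSet L)
    (Set.toFinite _)
  have hpos : 0 < q ^ (n - 1) := pow_pos (by omega) _
  rw [wt, ← htot]
  omega

/-- A nonzero codeword of weight less than `2q^{n-1}` has nonzero line sums. -/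
theorem line_sum_ne_zero (hn : 1 ≤ n) {c : PG n F → ZMod p}
    (hc : c ∈ code p n F) {a : ZMod p}
    (ha : ∀ u v : Fin (n + 1) → F, LinearIndependent F ![u, v] →
      vecFun c v + ∑ t : F, vecFun c (u + t • v) = a)
    (hc0 : c ≠ 0) (hwt : wt c < 2 * Fintype.card F ^ (n - 1)) : a ≠ 0 := by
  classical
  rintro rfl
  obtain ⟨P, hP⟩ := Function.ne_iff.1 hc0
  have hq : 1 < Fintype.card F := Fintype.one_lt_card
  -- Zero sum forces a second support point on each line through `P`, so two zeros would make the
  -- weight too large. At most one zero per line gives weight at least 1 + (q - 1)θ_{n-1} = q^n.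
  have hmany : ∀ w, w ∉ Submodule.span F {P.rep} → Fintype.card F - 1 ≤
      (Finset.univ.filter fun t : F => vecFun c (w + t • P.rep) ≠ 0).card := by
    intro w hw
    have hli := linearIndependent_pair_of_notMem_span P.rep_nonzero hw
    by_contra! hlt
    have hcompl := Finset.card_filter_add_card_filter_not (s := (Finset.univ : Finset F))
      (fun t => vecFun c (w + t • P.rep) ≠ 0)
    rw [Finset.card_univ] at hcompl
    obtain ⟨t₁, h₁, t₂, h₂, hne⟩ := Finset.one_lt_card.1 (show 1 <
      (Finset.univ.filter fun t : F => ¬ vecFun c (w + t • P.rep) ≠ 0).card by omega)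
    simp only [Finset.mem_filter, Finset.mem_univ, true_and, not_not] at h₁ h₂
    obtain ⟨t, ht⟩ : ∃ t : F, vecFun c (w + t • P.rep) ≠ 0 := by
      by_contra! h
      have := ha w P.rep (LinearIndependent.pair_symm_iff.1 hli)
      rw [Finset.sum_eq_zero fun t _ => h t, add_zero, vecFun_rep] at this
      exact hP this
    refine hwt.not_ge (two_mul_pow_le_wt hn hc ha hli ![1, 0] ![t, 1] ![t₁, 1] ?_ ?_ ?_ ?_ ?_
      fun _ => ⟨![t₂, 1], ?_, ?_⟩)
    · simp
    · simpa [vecFun_rep] using hP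
    · simpa [add_comm] using ht
    · exact fun h => one_ne_zero (congrFun h 1)
    · simpa [add_comm] using h₁
    · simpa [sub_eq_zero] using hne
    · simpa [add_comm] using h₂
  have hle := le_ncard_support_diff_singleton c P _ hmany
  rw [mul_comm] at hle
  have hle' := Nat.le_of_mul_le_mul_left hle (by omega)
  have htot := Set.ncard_sdiff_singleton_add_one (s := Function.support c) (a := P) hP
    (Set.toFinite _)
  have hpow : Fintype.card F ^ n = Fintype.card F * Fintype.card F ^ (n - 1) := by
    rw [← pow_succ', Nat.sub_add_cancel hn]
  have h2 : 2 * Fintype.card F ^ (n - 1) ≤ Fintype.card F ^ n := by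
    rw [hpow]; exact Nat.mul_le_mul_right _ hq
  rw [wt] at hwt
  omega

/-- Through every point in the support of a codeword of weight less than `2q^{n-1}` with nonzero
line sums, there is a line with no other point in the support. -/
theorem exists_tangent (hn : 1 ≤ n) {c : PG n F → ZMod p}
    (hc : c ∈ code p n F) {a : ZMod p}
    (ha : ∀ u v : Fin (n + 1) → F, LinearIndependent F ![u, v] →
      vecFun c v + ∑ t : F, vecFun c (u + t • v) = a)
    (ha0 : a ≠ 0) (hwt : wt c < 2 * Fintype.card F ^ (n - 1)) {P : PG n F} (hP : c P ≠ 0) :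
    ∃ w, w ∉ Submodule.span F {P.rep} ∧ ∀ t : F, vecFun c (w + t • P.rep) = 0 := by
  classical
  by_contra! hnot
  have hq : 1 < Fintype.card F := Fintype.one_lt_card
  -- A nontangent line with only one further support point would also have a zero, since q ≥ 2. Two
  -- further points on every line would give weight at least 1 + 2θ_{n-1} > 2q^(n-1).
  have hmany : ∀ w, w ∉ Submodule.span F {P.rep} → 2 ≤
      (Finset.univ.filter fun t : F => vecFun c (w + t • P.rep) ≠ 0).card := by
    intro w hw
    have hli := linearIndependent_pair_of_notMem_span P.rep_nonzero hw
    obtain ⟨t, ht⟩ := hnot w hw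
    by_contra! hlt
    obtain ⟨t₁, h₁⟩ := exists_ne t
    have hz : vecFun c (w + t₁ • P.rep) = 0 := by
      by_contra h
      exact h₁ (Finset.card_le_one.1 (Nat.le_of_lt_succ hlt) t₁ (by simpa using h)
        t (by simpa using ht))
    refine hwt.not_ge (two_mul_pow_le_wt hn hc ha hli ![1, 0] ![t, 1] ![t₁, 1] ?_ ?_ ?_ ?_ ?_
      fun h => absurd h ha0)
    · simp
    · simpa [vecFun_rep] using hP
    · simpa [add_comm] using ht
    · exact fun h => one_ne_zero (congrFun h 1)
    · simpa [add_comm] using hz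
  have hle := le_ncard_support_diff_singleton c P _ hmany
  have htot := Set.ncard_sdiff_singleton_add_one (s := Function.support c) (a := P) hP
    (Set.toFinite _)
  rw [wt] at hwt
  obtain ⟨k, hk⟩ := Nat.exists_eq_add_of_le' hn
  subst hk
  rw [Nat.add_sub_cancel] at hwt
  obtain ⟨r, hr⟩ := Nat.exists_eq_add_of_lt hq
  have hpos : 0 < Fintype.card F ^ k := pow_pos (by omega) _
  obtain ⟨y, hy⟩ := Nat.exists_eq_add_of_lt hpos
  rw [pow_succ', hy, hr] at hle
  rw [hy] at hwt
  have h3 : (1 + r + 1) * (0 + y + 1) - 1 = r * y + 2 * y + r + 1 := by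
    rw [show (1 + r + 1) * (0 + y + 1) = r * y + 2 * y + r + 1 + 1 by ring, Nat.add_sub_cancel]
  have h4 : (Function.support c \ {P}).ncard ≤ 2 * y := by omega
  rw [h3, Nat.add_sub_cancel] at hle
  have := hle.trans (Nat.mul_le_mul_left (1 + r) h4)
  nlinarith

end WeightBounds

/-! ### Lines, blocking sets and tangents. -/

section Lines

variable {n : ℕ} {F : Type*} [Field F]

/-- The points of a line, parametrized by `F ∪ {∞}`. -/
theorem IsLine.exists_param {L : Set (PG n F)} (hL : IsLine L) :
    ∃ (u v : Fin (n + 1) → F) (f : Option F → PG n F), LinearIndependent F ![u, v] ∧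
      Function.Injective f ∧ Set.range f = L ∧
      ∀ (R : Type) [Zero R] (c : PG n F → R),
        c (f none) = vecFun c v ∧ ∀ t, c (f (some t)) = vecFun c (u + t • v) := by
  obtain ⟨W, hW, rfl⟩ := hL
  have : Module.Finite F W := Module.finite_of_finrank_eq_succ hW
  let b := Module.finBasisOfFinrankEq F W hW
  set u : Fin (n + 1) → F := W.subtype (b 0) with hu
  set v : Fin (n + 1) → F := W.subtype (b 1) with hv
  have hli : LinearIndependent F ![u, v] := by
    have h := b.linearIndependent.map' W.subtype W.ker_subtype
    have he : ![u, v] = W.subtype ∘ b := by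
      ext i
      fin_cases i <;> rfl
    rwa [he]
  have hmem : ∀ x, x ∈ W → ∃ s t : F, x = s • u + t • v := fun x hx => by
    refine ⟨b.repr ⟨x, hx⟩ 0, b.repr ⟨x, hx⟩ 1, ?_⟩
    have h := congrArg W.subtype (b.sum_repr ⟨x, hx⟩)
    rw [Fin.sum_univ_two, map_add, map_smul, map_smul] at h
    exact h.symm
  have hpair := LinearIndependent.pair_iff.1 hli
  have hv0 : v ≠ 0 := hli.ne_zero 1
  have hu0 : ∀ t : F, u + t • v ≠ 0 := fun t h =>
    one_ne_zero (hpair 1 t (by simpa using h)).1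
  refine ⟨u, v, fun o => o.elim (Projectivization.mk F v hv0)
    (fun t => Projectivization.mk F (u + t • v) (hu0 t)), hli, ?_, ?_, ?_⟩
  · rintro (_ | s) (_ | t) h
    · rfl
    · obtain ⟨r, hr⟩ := (Projectivization.mk_eq_mk_iff' F _ _ _ _).1 h
      have := hpair r (r * t - 1) (by rw [← sub_eq_zero.2 hr]; module)
      simp [this.1] at this
    · obtain ⟨r, hr⟩ := (Projectivization.mk_eq_mk_iff' F _ _ _ _).1 h
      have := hpair (-1) (r - s) (by rw [← sub_eq_zero.2 hr]; module)
      simp at this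
    · obtain ⟨r, hr⟩ := (Projectivization.mk_eq_mk_iff' F _ _ _ _).1 h
      have := hpair (r - 1) (r * t - s) (by rw [← sub_eq_zero.2 hr]; module)
      have hr1 : r = 1 := sub_eq_zero.1 this.1
      rw [hr1, one_mul] at this
      rw [sub_eq_zero.1 this.2]
  · ext P
    rw [Set.mem_range]
    constructor
    · rintro ⟨_ | t, rfl⟩
      · exact (mk_mem_pointSet_iff hv0).2 (b 1).2
      · exact (mk_mem_pointSet_iff (hu0 t)).2 (add_mem (b 0).2 (W.smul_mem t (b 1).2))
    · intro hP
      obtain ⟨s, t, hst⟩ := hmem _ (rep_mem_iff_mem_pointSet.2 hP)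
      by_cases hs : s = 0
      · refine ⟨none, ?_⟩
        conv_rhs => rw [← P.mk_rep]
        symm
        exact (Projectivization.mk_eq_mk_iff' F _ _ _ _).2 ⟨t, by rw [hst, hs]; simp⟩
      · refine ⟨some (s⁻¹ * t), ?_⟩
        conv_rhs => rw [← P.mk_rep]
        symm
        refine (Projectivization.mk_eq_mk_iff' F _ _ _ _).2 ⟨s, ?_⟩
        rw [hst, smul_add, smul_smul, mul_inv_cancel_left₀ hs]
  · exact fun R _ c => ⟨(vecFun_of_ne_zero c hv0).symm, fun t =>
      (vecFun_of_ne_zero c (hu0 t)).symm⟩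

variable [Fintype F]

theorem IsLine.finsum_eq {p : ℕ} {c : PG n F → ZMod p} {a : ZMod p}
    (ha : ∀ u v : Fin (n + 1) → F, LinearIndependent F ![u, v] →
      vecFun c v + ∑ t : F, vecFun c (u + t • v) = a)
    {L : Set (PG n F)} (hL : IsLine L) : ∑ᶠ P ∈ L, c P = a := by
  obtain ⟨u, v, f, hli, hinj, rfl, hf⟩ := hL.exists_param
  obtain ⟨h1, h2⟩ := hf (ZMod p) c
  rw [finsum_mem_range hinj, finsum_eq_sum_of_fintype, Fintype.sum_option, h1,
    Finset.sum_congr rfl fun t _ => h2 t, ha u v hli]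

theorem isBlockingSet_support {p : ℕ} {c : PG n F → ZMod p} {a : ZMod p}
    (ha : ∀ u v : Fin (n + 1) → F, LinearIndependent F ![u, v] →
      vecFun c v + ∑ t : F, vecFun c (u + t • v) = a)
    (ha0 : a ≠ 0) : IsBlockingSet (Function.support c) := by
  intro L hL
  obtain ⟨P, hP, hcP⟩ := exists_ne_zero_of_finsum_mem_ne_zero ((hL.finsum_eq ha).trans_ne ha0)
  exact ⟨P, hP, hcP⟩

/-- If all line sums of `a • v_B` are `a ≠ 0`, then all lines meet `B` in `1 (mod p)` points. -/
theorem IsLine.ncard_inter_modEq_one {p : ℕ} [Fact p.Prime] {B : Set (PG n F)} {a : ZMod p}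
    (ha0 : a ≠ 0)
    (ha : ∀ u v : Fin (n + 1) → F, LinearIndependent F ![u, v] →
      vecFun (a • incidenceVector p B) v +
        ∑ t : F, vecFun (a • incidenceVector p B) (u + t • v) = a)
    {L : Set (PG n F)} (hL : IsLine L) : (L ∩ B).ncard ≡ 1 [MOD p] := by
  classical
  have h := hL.finsum_eq ha
  have h1 : ∑ᶠ P ∈ L, (a • incidenceVector p B) P = ∑ᶠ P ∈ L ∩ B, a := by
    rw [finsum_mem_def, finsum_mem_def]
    refine finsum_congr fun P => ?_
    by_cases hPL : P ∈ L <;> by_cases hPB : P ∈ B <;> simp [incidenceVector, hPL, hPB]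
  rw [h1, finsum_mem_eq_finite_toFinset_sum _ (Set.toFinite (L ∩ B)), Finset.sum_const,
    ← Set.ncard_eq_toFinset_card, nsmul_eq_mul] at h
  rw [← ZMod.natCast_eq_natCast_iff, Nat.cast_one]
  exact mul_right_cancel₀ ha0 (h.trans (one_mul a).symm)

/-- A blocking set that has a tangent line at each of its points is minimal. -/
theorem IsBlockingSet.isMinimal_of_tangents {F : Type*} [Field F] {B : Set (PG n F)}
    (hB : IsBlockingSet B)
    (htan : ∀ P ∈ B, ∃ L, IsLine L ∧ L ∩ B ⊆ {P}) : IsMinimalBlockingSet B := by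
  refine ⟨hB, fun B' hB' hblock => ?_⟩
  obtain ⟨P, hP, hP'⟩ := Set.exists_of_ssubset hB'
  obtain ⟨L, hL, hLP⟩ := htan P hP
  obtain ⟨Q, hQL, hQB'⟩ := hblock L hL
  have : Q = P := hLP ⟨hQL, hB'.1 hQB'⟩
  exact hP' (this ▸ hQB')

theorem isLine_span_pair {F : Type*} [Field F] {r w : Fin (n + 1) → F}
    (h : LinearIndependent F ![r, w]) : IsLine (pointSet (Submodule.span F {r, w})) := by
  refine ⟨_, ?_, rfl⟩
  have := finrank_span_eq_card h
  rwa [Matrix.range_cons_cons_empty, Fintype.card_fin] at this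

theorem inter_support_subset_singleton {F : Type*} [Field F] {R : Type*} [Zero R]
    {c : PG n F → R} {P : PG n F} {w : Fin (n + 1) → F}
    (hw : ∀ t : F, vecFun c (w + t • P.rep) = 0) :
    pointSet (Submodule.span F {P.rep, w}) ∩ Function.support c ⊆ {P} := by
  rintro Q ⟨hQ, hcQ⟩
  obtain ⟨x, y, hxy⟩ := Submodule.mem_span_pair.1 (rep_mem_iff_mem_pointSet.2 hQ)
  by_cases hy : y = 0
  · rw [Set.mem_singleton_iff, ← Q.mk_rep, ← P.mk_rep, Projectivization.mk_eq_mk_iff']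
    exact ⟨x, by rw [← hxy, hy]; simp⟩
  · refine absurd ?_ hcQ
    rw [← vecFun_rep c Q, ← hw (y⁻¹ * x), ← vecFun_smul_vec c hy (w + _), smul_add,
      smul_smul, mul_inv_cancel_left₀ hy, add_comm (y • w), hxy]

end Lines

/-! ### Size of linear blocking sets. -/

section LinearBlockingSets

variable {p h n : ℕ} [Fact p.Prime] {F : Type*} [Field F] [Fintype F] [Algebra (ZMod p) F]

/-- Each point of `B(U)` contributes the p - 1 nonzero `𝔽_p`-multiples of a vector of `U`, and
distinct points share no nonzero vector. -/
theorem mul_ncard_spreadBlock_le (U : Submodule (ZMod p) (Fin (n + 1) → F)) :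
    (p - 1) * (spreadBlock U).ncard ≤ p ^ Module.finrank (ZMod p) U - 1 := by
  classical
  have hx : ∀ P : spreadBlock U, ∃ x : Fin (n + 1) → F, x ∈ U ∧ x ≠ 0 ∧ x ∈ P.1.submodule := by
    rintro ⟨P, hP⟩
    obtain ⟨x, hx, hx0⟩ := Submodule.exists_mem_ne_zero_of_ne_bot hP
    exact ⟨x, hx.1, hx0, hx.2⟩
  choose x hxU hx0 hxP using hx
  have hmk : ∀ (P : spreadBlock U) (y : Fin (n + 1) → F) (hy : y ≠ 0), y ∈ P.1.submodule →
      Projectivization.mk F y hy = P.1 := fun P y hy hyP => by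
    rw [P.1.submodule_eq, Submodule.mem_span_singleton] at hyP
    conv_rhs => rw [← P.1.mk_rep]
    exact (Projectivization.mk_eq_mk_iff' F _ _ _ _).2 hyP
  let g : (ZMod p)ˣ × spreadBlock U → {y : U // y ≠ 0} := fun a =>
    ⟨⟨a.1 • x a.2, U.smul_mem (a.1 : ZMod p) (hxU a.2)⟩, fun h0 => by
      have h1 : (a.1 : ZMod p) • x a.2 = 0 := congrArg Subtype.val h0
      exact (smul_ne_zero a.1.ne_zero (hx0 a.2)) h1⟩
  have hg : Function.Injective g := by
    rintro ⟨l, P⟩ ⟨m, Q⟩ hlm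
    have heq : (l : ZMod p) • x P = (m : ZMod p) • x Q :=
      congrArg (fun y => (y.1 : Fin (n + 1) → F)) hlm
    have hPQ : P = Q := by
      have hne := smul_ne_zero l.ne_zero (hx0 P)
      refine Subtype.ext ((hmk P _ hne ?_).symm.trans (hmk Q _ hne ?_))
      · exact (P.1.submodule.restrictScalars (ZMod p)).smul_mem _ (hxP P)
      · rw [heq]
        exact (Q.1.submodule.restrictScalars (ZMod p)).smul_mem _ (hxP Q)
    subst hPQ
    exact Prod.ext (Units.ext (smul_left_injective (ZMod p) (hx0 P) heq)) rfl
  have hcard := Nat.card_le_card_of_injective g hg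
  rw [Nat.card_prod, Nat.card_eq_fintype_card (α := (ZMod p)ˣ), ZMod.card_units p,
    Nat.card_coe_set_eq] at hcard
  refine hcard.trans_eq ?_
  have : Fintype U := Fintype.ofFinite U
  rw [Nat.card_eq_fintype_card, Fintype.card_subtype_compl, Fintype.card_subtype_eq,
    Module.card_eq_pow_finrank (K := ZMod p) (V := U), ZMod.card]

theorem IsLinearBlockingSet.ncard_lt (hF : Fintype.card F = p ^ h) {B : Set (PG n F)}
    (hB : IsLinearBlockingSet p h B) : B.ncard < 2 * Fintype.card F ^ (n - 1) := by
  obtain ⟨U, hU, rfl⟩ := hB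
  have hle := mul_ncard_spreadBlock_le U
  have hp := (Fact.out : p.Prime).two_le
  rw [hU, pow_succ, pow_mul, ← hF] at hle
  have hpos : 0 < Fintype.card F ^ (n - 1) := pow_pos Fintype.card_pos _
  by_contra! hge
  have h1 := (Nat.mul_le_mul_left (p - 1) hge).trans hle
  obtain ⟨r, rfl⟩ := Nat.exists_eq_add_of_le' hp
  rw [show r + 2 - 1 = r + 1 by omega] at h1
  -- This is p ≤ 2(p - 1) with p = r + 2; the vector count allows only p q^(n-1) - 1.
  have h2 : Fintype.card F ^ (n - 1) * (r + 2) ≤ (r + 1) * (2 * Fintype.card F ^ (n - 1)) := by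
    nlinarith
  have h3 : 0 < Fintype.card F ^ (n - 1) * (r + 2) := Nat.mul_pos hpos (by omega)
  omega

/-- A linear blocking set whose incidence vector is a codeword is no larger than a hyperplane. -/
theorem IsLinearBlockingSet.ncard_le_theta (hn : 1 ≤ n) (hF : Fintype.card F = p ^ h)
    {B : Set (PG n F)} (hB : IsLinearBlockingSet p h B) (hc : incidenceVector p B ∈ code p n F) :
    B.ncard ≤ theta (Fintype.card F) (n - 1) := by
  classical
  have hq : 1 < Fintype.card F := Fintype.one_lt_card
  have hsupp : Function.support (incidenceVector p B) = B := by
    ext P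
    by_cases hP : P ∈ B <;> simp [incidenceVector, hP]
  have hlt := hB.ncard_lt hF
  have hwt : wt (incidenceVector p B) < 2 * Fintype.card F ^ (n - 1) := by rwa [wt, hsupp]
  have hpow : Fintype.card F ^ n = Fintype.card F * Fintype.card F ^ (n - 1) := by
    rw [← pow_succ', Nat.sub_add_cancel hn]
  by_cases hc0 : incidenceVector p B = 0
  · rw [← hsupp, hc0]
    simp
  obtain ⟨a, ha⟩ := exists_line_sum hc
  have ha0 := line_sum_ne_zero hn hc ha hc0 hwt
  -- The whole space has θ_n ≥ 2q^(n-1) points, too many for `B`.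
  obtain ⟨P, hP⟩ : ∃ P, P ∉ B := by
    by_contra! hall
    have hcard := Projectivization.card' F (Fin (n + 1) → F)
    rw [← Set.ncard_univ (ℙ F (Fin (n + 1) → F)), ← Set.eq_univ_of_forall hall,
      Nat.card_eq_fintype_card, Nat.card_eq_fintype_card, Fintype.card_fun, Fintype.card_fin,
      pow_succ', hpow] at hcard
    obtain ⟨r, hr⟩ := Nat.exists_eq_add_of_le hq
    have hpos : 0 < Fintype.card F ^ (n - 1) := pow_pos Fintype.card_pos _
    rw [hr, show Nat.succ 1 + r - 1 = 1 + r by omega, ← hr] at hcard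
    have h1 := Nat.mul_le_mul_right (1 + r) (Nat.le_pred_of_lt hlt)
    set y := Fintype.card F ^ (n - 1)
    obtain ⟨z, hz⟩ := Nat.exists_eq_add_of_lt hpos
    rw [hz, show (2 * (0 + z + 1)).pred = 2 * z + 1 by simp; omega] at h1
    rw [hz, hr] at hcard
    simp only [Nat.succ_eq_add_one] at hcard
    nlinarith [Nat.zero_le (r * r * z), Nat.zero_le (r * z), Nat.zero_le (r * r)]
  -- Two support points on a line through `P` would, with the zero at `P`, force weight at least
  -- 2q^(n-1); one zero suffices because `a ≠ 0`.
  have hfew : ∀ w, w ∉ Submodule.span F {P.rep} →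
      (Finset.univ.filter fun t : F =>
        vecFun (incidenceVector p B) (w + t • P.rep) ≠ 0).card ≤ 1 := by
    intro w hw
    by_contra! hgt
    obtain ⟨t₁, h₁, t₂, h₂, hne⟩ := Finset.one_lt_card.1 hgt
    simp only [Finset.mem_filter, Finset.mem_univ, true_and] at h₁ h₂
    refine hwt.not_ge (two_mul_pow_le_wt hn hc ha
      (linearIndependent_pair_of_notMem_span P.rep_nonzero hw) ![t₁, 1] ![t₂, 1] ![1, 0]
      ?_ ?_ ?_ ?_ ?_ fun h => absurd h ha0)
    · simpa [sub_eq_zero] using hne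
    · simpa [add_comm] using h₁
    · simpa [add_comm] using h₂
    · exact fun h => one_ne_zero (congrFun h 0)
    · simp [vecFun_rep, incidenceVector, hP]
  have hle := ncard_support_diff_singleton_le (incidenceVector p B) P 1 hfew
  rw [hsupp, Set.sdiff_singleton_eq_self hP, mul_one, ← theta_mul hn, mul_comm] at hle
  exact Nat.le_of_mul_le_mul_right hle (by omega)

end LinearBlockingSets

/-! ### Conclusion. -/

theorem mainTheorem2 (p h q n : ℕ) [Fact p.Prime] (hq : q = p ^ h) (hn : 1 ≤ n)
    (F : Type*) [Field F] [Fintype F] [Algebra (ZMod p) F] (hF : Fintype.card F = q)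
    (c : PG n F → ZMod p) (hc : c ∈ code p n F)
    (hlow : theta q (n - 1) < wt c) (hupp : wt c < 2 * q ^ (n - 1)) :
    ∃ (a : ZMod p) (B : Set (PG n F)),
      a ≠ 0 ∧ c = a • incidenceVector p B ∧
      IsMinimalBlockingSet B ∧
      ¬ IsLinearBlockingSet p h B ∧
      ∀ L : Set (PG n F), IsLine L → (L ∩ B).ncard ≡ 1 [MOD p] := by
  subst hF
  obtain ⟨a, ha⟩ := exists_line_sum hc
  have hc0 : c ≠ 0 := by
    rintro rfl
    simp [wt] at hlow
  have ha0 := line_sum_ne_zero hn hc ha hc0 hupp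
  have htan : ∀ P, c P ≠ 0 → ∃ w, LinearIndependent F ![P.rep, w] ∧
      ∀ t : F, vecFun c (w + t • P.rep) = 0 := fun P hP =>
    let ⟨w, hw, hw'⟩ := exists_tangent hn hc ha ha0 hupp hP
    ⟨w, linearIndependent_pair_of_notMem_span P.rep_nonzero hw, hw'⟩
  -- On a tangent at `P` the line sum `a` reduces to the single term `c P`.
  have hval : ∀ P, c P ≠ 0 → c P = a := fun P hP => by
    obtain ⟨w, hli, hw⟩ := htan P hP
    rw [← ha w P.rep (LinearIndependent.pair_symm_iff.1 hli),
      Finset.sum_eq_zero fun t _ => hw t, add_zero, vecFun_rep]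
  have hcB : c = a • incidenceVector p (Function.support c) := by
    ext P
    by_cases hP : c P = 0
    · simp [incidenceVector, hP]
    · rw [hval P hP, Pi.smul_apply, incidenceVector, Set.indicator_of_mem hP, smul_eq_mul, mul_one]
  have hmem : incidenceVector p (Function.support c) ∈ code p n F := by
    have := (code p n F).smul_mem a⁻¹ hc
    rwa [hcB, smul_smul, inv_mul_cancel₀ ha0, one_smul] at this
  refine ⟨a, Function.support c, ha0, hcB, ?_, ?_, fun L hL => ?_⟩
  · refine (isBlockingSet_support ha ha0).isMinimal_of_tangents fun P hP => ?_
    obtain ⟨w, hli, hw⟩ := htan P hP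
    exact ⟨_, isLine_span_pair hli, inter_support_subset_singleton hw⟩
  · intro hlin
    exact hlow.not_ge (hlin.ncard_le_theta hn hq hmem)
  · refine hL.ncard_inter_modEq_one ha0 ?_
    rwa [← hcB]
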